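/- Let $d\ge 2$ and $n\ge 0$ be integers. Let $\mathcal H_n^d$ be the space of real polynomials on $\mathbb R^d$ that are homogeneous of degree $n$ and harmonic ($\Delta Y=\partial_1^2Y+\dots+\partial_d^2Y=0$), let $d\sigma$ be the (unnormalized) surface area measure on the unit sphere $\mathbb S^{d-1}\subset\mathbb R^d$, and let $\omega_m=2\pi^{m/2}/\Gamma(m/2)$ be the surface area of $\mathbb S^{m-1}$ (so $\omega_1=2$). For $\lambda>0$ let $C_n^\lambda$ be the Gegenbauer polynomial $$C_n^\lambda(t)=\frac{(\lambda)_n2^n}{n!}\sum_{j=0}^{\lfloor n/2\rfloor}\frac{(-\frac n2)_j(\frac{1-n}2)_j}{j!\,(1-n-\lambda)_j}\,t^{n-2j},\qquad (a)_j=a(a+1)\cdots(a+j-1).$$ Put $\lambda=\frac{d-2}2$; for $d=2$, where $\lambda=0$, the quotient $C_n^0(t)/C_n^0(1)$ denotes the limit $\lim_{\mu\to0+}C_n^\mu(t)/C_n^\mu(1)=T_n(t)$, the Chebyshev polynomial of the first kind ($T_n(\cos\theta)=\cos n\theta$). Let $f$ be a real-valued measurable function on $(-1,1)$ (its values at $\pm1$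 may be chosen arbitrarily) such that $$\int_{-1}^1|f(t)|\,(1-t^2)^{\frac{d-3}2}\,dt<\infty .$$ Then the integral defining $$\lambda_n(f):=\omega_{d-1}\int_{-1}^1 f(t)\,\frac{C_n^\lambda(t)}{C_n^\lambda(1)}\,(1-t^2)^{\frac{d-3}2}\,dt$$ converges absolutely, and for every $Y_n\in\mathcal H_n^d$ and every $x\in\mathbb S^{d-1}$ the function $y\mapsto f(\langle x,y\rangle)Y_n(y)$ is integrable on $\mathbb S^{d-1}$ and $$\int_{\mathbb S^{d-1}}f(\langle x,y\rangle)\,Y_n(y)\,d\sigma(y)=\lambda_n(f)\,Y_n(x).$$ -/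

import Mathlib

noncomputable section

namespace SphericalHarmonics

open MeasureTheory

/-- The Laplacian `Δ = ∂₁² + ⋯ + ∂_d²` on real polynomials in `d` variables. -/
def polyLaplacian (d : ℕ) : MvPolynomial (Fin d) ℝ →ₗ[ℝ] MvPolynomial (Fin d) ℝ :=
  ∑ i : Fin d, (MvPolynomial.pderiv i).toLinearMap ∘ₗ (MvPolynomial.pderiv i).toLinearMap

/-- The space `𝓗_n^d` of real harmonic polynomials on `ℝ^d`, homogeneous of degree `n`. -/
def harmonicSpace (d n : ℕ) : Submodule ℝ (MvPolynomial (Fin d) ℝ) :=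
  MvPolynomial.homogeneousSubmodule (Fin d) ℝ n ⊓ LinearMap.ker (polyLaplacian d)

/-- The unit sphere `𝕊^{d-1}` of the Euclidean space `ℝ^d`. -/
abbrev unitSphere (d : ℕ) : Set (EuclideanSpace ℝ (Fin d)) :=
  Metric.sphere (0 : EuclideanSpace ℝ (Fin d)) 1

/-- The surface area measure `σ` on `𝕊^{d-1}` (not normalized). -/
abbrev surfaceMeasure (d : ℕ) : Measure (unitSphere d) :=
  (volume : Measure (EuclideanSpace ℝ (Fin d))).toSphere

/-- The surface area `ω_d` of `𝕊^{d-1}`; in particular `ω_1 = 2`. -/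
def surfaceArea (d : ℕ) : ℝ :=
  (surfaceMeasure d).real Set.univ

/-- The Pochhammer symbol `(a)_k = a (a + 1) ⋯ (a + k - 1)`. -/
def pochhammer (a : ℝ) (k : ℕ) : ℝ :=
  (ascPochhammer ℝ k).eval a

/-- The Gegenbauer polynomial `C_n^μ` for `μ > 0`:
`C_n^μ(t) = ((μ)_n 2^n / n!) t^n ₂F₁(-n/2, (1-n)/2; 1-n-μ; 1/t²)`.
The hypergeometric series terminates after the index `⌊n/2⌋`; the factor `t^n` has been multiplied
into it, so that the formula also gives the value of the polynomial at `t = 0`. -/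
def gegenbauer (μ : ℝ) (n : ℕ) (t : ℝ) : ℝ :=
  pochhammer μ n * 2 ^ n / (n.factorial : ℝ) *
    ∑ j ∈ Finset.range (n / 2 + 1),
      pochhammer (-(n : ℝ) / 2) j * pochhammer ((1 - (n : ℝ)) / 2) j /
        ((j.factorial : ℝ) * pochhammer (1 - (n : ℝ) - μ) j) * t ^ (n - 2 * j)

/-- The quotient `C_n^μ(t) / C_n^μ(1)`, with `μ = (d - 2) / 2`, for `d ≥ 2`. If `d = 2`, then
`μ = 0` and the quotient stands for its limit as `μ → 0+`, the Chebyshev polynomial `T_n(t)`. -/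
def gegenbauerQuotient (d n : ℕ) (t : ℝ) : ℝ :=
  if d = 2 then (Polynomial.Chebyshev.T ℝ (n : ℤ)).eval t
  else gegenbauer (((d : ℝ) - 2) / 2) n t / gegenbauer (((d : ℝ) - 2) / 2) n 1

/-- The weight `(1 - t²)^{(d-3)/2}`. -/
def weight (d : ℕ) (t : ℝ) : ℝ :=
  (1 - t ^ 2) ^ (((d : ℝ) - 3) / 2)

/-- The constant
`λ_n(f) = ω_{d-1} ∫_{-1}^1 f(t) (C_n^μ(t) / C_n^μ(1)) (1 - t²)^{(d-3)/2} dt`, `μ = (d - 2) / 2`. -/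
def funkHeckeConstant (d n : ℕ) (f : ℝ → ℝ) : ℝ :=
  surfaceArea (d - 1) * ∫ t in Set.Ioo (-1 : ℝ) 1, f t * gegenbauerQuotient d n t * weight d t

end SphericalHarmonics

end

/-! For `f(t) = t^k` both sides obey the same recursion. Write `P_n` for the Gegenbauer quotient and
`L = ⟨x, ·⟩` with `|x| = 1`. The differential equation and first-order relation of `P_n`, with one
integration by parts, give `zonalMoment_succ`, which lowers `n` and `k` together. On the sphere,
integration by parts against a Gaussian followed by polar coordinates gives `(m + d - 1) ∫ y_i q = ∫
∂_i q` for `q` homogeneous of degree `m` (`sphereIntegral_X_mul`). Taking `q = L^k ∂_i Y` and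
summing over `i`, Euler's identity and harmonicity reduce `L^k Y` to `L^(k-1) D_x Y`, where `D_x Y`
is harmonic of one degree less and takes the value `n Y(x)` at `x` when `Y` has degree `n`.
Induction on `n` proves the formula for powers (`sphereIntegral_linearForm_pow_mul`), hence for
polynomials. The case `n = 0` identifies the moments of the law of `⟨x, y⟩`, so this law is
`zonalMeasure` (`map_inner_surfaceMeasure`). Polynomials are dense in its `L¹` space and both sides
are `L¹`-continuous in `f`, which settles the general case. -/

namespace SphericalHarmonics

open Polynomial

/-! ### Gegenbauer polynomials: coefficients, derivative relation, differential equation. -/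

/-- The coefficient of `t ^ (n - 2 * j)` in the Gegenbauer polynomial `C_n^μ`. -/
noncomputable def gegenbauerCoeff (μ : ℝ) (n j : ℕ) : ℝ :=
  pochhammer μ n * 2 ^ n / (n.factorial : ℝ) *
    (pochhammer (-(n : ℝ) / 2) j * pochhammer ((1 - (n : ℝ)) / 2) j /
      ((j.factorial : ℝ) * pochhammer (1 - (n : ℝ) - μ) j))

/-- The Gegenbauer polynomial `C_n^μ` as a polynomial. -/
noncomputable def gegenbauerPoly (μ : ℝ) (n : ℕ) : ℝ[X] :=
  ∑ j ∈ Finset.range (n / 2 + 1), C (gegenbauerCoeff μ n j) * X ^ (n - 2 * j)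

theorem eval_gegenbauerPoly (μ : ℝ) (n : ℕ) (t : ℝ) :
    (gegenbauerPoly μ n).eval t = gegenbauer μ n t := by
  simp only [gegenbauerPoly, gegenbauer, gegenbauerCoeff, eval_finsetSum, eval_mul, eval_C,
    eval_pow, eval_X, Finset.mul_sum]
  exact Finset.sum_congr rfl fun j _ => by ring

theorem pochhammer_zero (a : ℝ) : pochhammer a 0 = 1 := by simp [pochhammer]

theorem pochhammer_succ (a : ℝ) (k : ℕ) :
    pochhammer a (k + 1) = pochhammer a k * (a + k) := by
  simp [pochhammer, ascPochhammer_succ_eval]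

/-- The term ratio of the hypergeometric series. Since `0⁻¹ = 0` keeps inversion multiplicative, no
denominator has to be nonzero. -/
theorem gegenbauerCoeff_succ_right (μ : ℝ) (n j : ℕ) :
    gegenbauerCoeff μ n (j + 1) = gegenbauerCoeff μ n j *
      ((-(n : ℝ) / 2 + j) * ((1 - (n : ℝ)) / 2 + j) / ((j + 1) * (1 - (n : ℝ) - μ + j))) := by
  simp only [gegenbauerCoeff, pochhammer_succ, Nat.factorial_succ]
  push_cast
  simp only [div_eq_mul_inv, mul_inv]
  ring

theorem gegenbauerCoeff_recurrence {μ : ℝ} {n j : ℕ} (h : 1 - (n : ℝ) - μ + j ≠ 0) :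
    4 * (j + 1) * (1 - n - μ + j) * gegenbauerCoeff μ n (j + 1) =
      (n - 2 * j) * (n - 1 - 2 * j) * gegenbauerCoeff μ n j := by
  have h3 : (j : ℝ) + 1 ≠ 0 := by positivity
  rw [gegenbauerCoeff_succ_right]
  field_simp
  ring

theorem gegenbauerCoeff_succ_zero (μ : ℝ) (n : ℕ) :
    (n + 1) * gegenbauerCoeff μ (n + 1) 0 = 2 * (n + μ) * gegenbauerCoeff μ n 0 := by
  have h1 : (n.factorial : ℝ) ≠ 0 := by positivity
  have h2 : (n : ℝ) + 1 ≠ 0 := by positivity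
  simp only [gegenbauerCoeff, pochhammer_zero, pochhammer_succ, Nat.factorial_succ, Nat.factorial_zero]
  push_cast
  field_simp
  ring

/-- The term ratios in `j` for degrees `n` and `n + 1` are compatible with this relation, so it
propagates from `j = 0`. With `μ > 0`, the bound `j ≤ n` keeps every denominator met on the way
nonzero. -/
theorem mul_gegenbauerCoeff_succ_left {μ : ℝ} (hμ : 0 < μ) (n j : ℕ) (hj : j ≤ n) :
    (n + 1 - 2 * j) * gegenbauerCoeff μ (n + 1) j = 2 * (n + μ - j) * gegenbauerCoeff μ n j := by
  induction j with
  | zero => simpa using gegenbauerCoeff_succ_zero μ n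
  | succ j ih =>
    have hjn : (j : ℝ) + 1 ≤ n := by exact_mod_cast hj
    have ih := ih (by omega)
    have h1 : (n + μ - j : ℝ) ≠ 0 := by linarith
    have h3 : (j : ℝ) + 1 ≠ 0 := by positivity
    have r1 := gegenbauerCoeff_recurrence (μ := μ) (n := n + 1) (j := j) (by push_cast; linarith)
    have r2 := gegenbauerCoeff_recurrence (μ := μ) (n := n) (j := j) (by linarith)
    push_cast at r1 ⊢
    refine mul_left_cancel₀ (mul_ne_zero h1 h3) ?_
    linear_combination (-(n - 1 - 2 * j) / 4 : ℝ) * r1 + ((n + μ - j) / 2 : ℝ) * r2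
      - ((n - 1 - 2 * j) * (n - 2 * j) / 4 : ℝ) * ih

theorem gegenbauerCoeff_succ_succ {μ : ℝ} (hμ : 0 < μ) (n j : ℕ) (hj : j ≤ n) :
    2 * (j + 1) * gegenbauerCoeff μ (n + 1) (j + 1) = -(n - 2 * j) * gegenbauerCoeff μ n j := by
  have hjn : (j : ℝ) ≤ n := by exact_mod_cast hj
  have h := mul_gegenbauerCoeff_succ_left hμ n j hj
  rw [gegenbauerCoeff_succ_right]
  push_cast
  have h1 : (1 - ((n : ℝ) + 1) - μ + j) ≠ 0 := by linarith
  have h3 : (j : ℝ) + 1 ≠ 0 := by positivity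
  field_simp
  linear_combination (n - 2 * j : ℝ) * h

/-- One of the two numerator Pochhammer symbols reaches the factor zero, which one depending on the
parity of `n`. This removes the remainder terms of the truncated identities below. -/
theorem gegenbauerCoeff_half_add_one (μ : ℝ) (n : ℕ) : gegenbauerCoeff μ n (n / 2 + 1) = 0 := by
  rw [gegenbauerCoeff_succ_right]
  rcases Nat.even_or_odd' n with ⟨m, rfl | rfl⟩
  · have : 2 * m / 2 = m := by omega
    rw [this]; push_cast; ring
  · have : (2 * m + 1) / 2 = m := by omega
    rw [this]; push_cast; ring

theorem X_mul_derivative_monomial (a : ℝ) (m : ℕ) :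
    X * derivative (C a * X ^ m) = C (m : ℝ) * (C a * X ^ m) := by
  cases m with
  | zero => simp
  | succ m => simp; ring

theorem X_sq_mul_derivative_monomial (a : ℝ) (m : ℕ) :
    X ^ 2 * derivative (derivative (C a * X ^ m)) = C ((m : ℝ) * (m - 1)) * (C a * X ^ m) := by
  rcases m with _ | _ | m
  · simp
  · simp
  · simp; ring

theorem X_mul_monomial_pred {a : ℝ} {n j : ℕ} (h : 2 * j ≤ n ∨ a = 0) :
    X * (C a * X ^ (n - 2 * j)) = C a * X ^ (n + 1 - 2 * j) := by
  rcases h with h | rfl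
  · rw [Nat.succ_sub h, pow_succ]; ring
  · simp

/-- Truncated after `J` terms, the derivative relation fails by a single monomial, and the induction
telescopes it. The factor `X` makes differentiation diagonal on monomials; the bound on `J` keeps
the remainder exponent free of truncated subtraction. -/
theorem gegenbauerPoly_derivative_partial {μ : ℝ} (hμ : 0 < μ) (n J : ℕ) (hJ : 2 * J ≤ n + 3) :
    X * ((1 - X ^ 2) * derivative (∑ j ∈ Finset.range J,
          C (gegenbauerCoeff μ (n + 1) j) * X ^ (n + 1 - 2 * j))
        - C (n + 2 * μ) * ∑ j ∈ Finset.range J, C (gegenbauerCoeff μ n j) * X ^ (n - 2 * j)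
        + C ((n : ℝ) + 1) * X * ∑ j ∈ Finset.range J,
          C (gegenbauerCoeff μ (n + 1) j) * X ^ (n + 1 - 2 * j)) =
      - C (2 * J * gegenbauerCoeff μ (n + 1) J) * X ^ (n + 3 - 2 * J) := by
  induction J with
  | zero => simp
  | succ j ih =>
    have ih := ih (by omega)
    have hjn : j ≤ n := by omega
    have hm : 2 * j ≤ n + 1 := by omega
    have hB := mul_gegenbauerCoeff_succ_left hμ n j hjn
    have hC := gegenbauerCoeff_succ_succ hμ n j hjn
    -- The bound `2 * j ≤ n` can fail only for `n + 1 = 2 * j`; then the left side of `hB` is zero,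
    -- which forces the coefficient to vanish.
    have hdeg : 2 * j ≤ n ∨ gegenbauerCoeff μ n j = 0 := by
      rcases Nat.lt_or_ge n (2 * j) with h | h
      · right
        have h2 : (n : ℝ) + 1 = 2 * j := by exact_mod_cast (by omega : n + 1 = 2 * j)
        have hjn' : (j : ℝ) ≤ n := by exact_mod_cast hjn
        rw [h2, sub_self, zero_mul, eq_comm, mul_eq_zero] at hB
        exact hB.resolve_left (by linarith)
      · exact Or.inl h
    have hd := X_mul_derivative_monomial (gegenbauerCoeff μ (n + 1) j) (n + 1 - 2 * j)
    have hp := X_mul_monomial_pred (j := j) hdeg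
    have hcast : ((n + 1 - 2 * j : ℕ) : ℝ) = n + 1 - 2 * j := by push_cast [hm]; ring
    rw [hcast] at hd
    have e1 : n + 3 - 2 * (j + 1) = n + 1 - 2 * j := by omega
    have e2 : n + 3 - 2 * j = n + 1 - 2 * j + 2 := by omega
    rw [Finset.sum_range_succ, Finset.sum_range_succ, derivative_add, e1]
    rw [e2, pow_add] at ih
    generalize derivative (C (gegenbauerCoeff μ (n + 1) j) * X ^ (n + 1 - 2 * j)) = D at *
    have hB' := congrArg (C : ℝ → ℝ[X]) hB
    have hC' := congrArg (C : ℝ → ℝ[X]) hC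
    simp only [map_mul, map_add, map_sub, map_neg, map_one, map_natCast, map_ofNat, Nat.cast_add,
      Nat.cast_one] at *
    linear_combination ih + (1 - X ^ 2) * hd - (n + 2 * C μ) * hp
      + X ^ (n + 1 - 2 * j) * hB' + X ^ (n + 1 - 2 * j) * hC'

theorem gegenbauerPoly_derivative {μ : ℝ} (hμ : 0 < μ) (n : ℕ) :
    (1 - X ^ 2) * derivative (gegenbauerPoly μ (n + 1)) =
      C (n + 2 * μ) * gegenbauerPoly μ n - C ((n : ℝ) + 1) * X * gegenbauerPoly μ (n + 1) := by
  have h := gegenbauerPoly_derivative_partial hμ n ((n + 1) / 2 + 1) (by omega)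
  rw [gegenbauerCoeff_half_add_one] at h
  -- For odd `n` this range has one term more than `gegenbauerPoly μ n`, and its coefficient is
  -- zero.
  have hs : ∑ j ∈ Finset.range ((n + 1) / 2 + 1), C (gegenbauerCoeff μ n j) * X ^ (n - 2 * j) =
      gegenbauerPoly μ n := by
    rw [gegenbauerPoly]
    rcases Nat.even_or_odd' n with ⟨m, rfl | rfl⟩
    · congr 2; omega
    · have e : (2 * m + 1 + 1) / 2 = (2 * m + 1) / 2 + 1 := by omega
      rw [e, Finset.sum_range_succ, gegenbauerCoeff_half_add_one]
      simp
  rw [hs, ← gegenbauerPoly, mul_zero, C_0, neg_zero, zero_mul, mul_eq_zero] at h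
  linear_combination h.resolve_left X_ne_zero

/-- The same telescoping, with `X ^ 2` making second derivatives diagonal on monomials. -/
theorem gegenbauerPoly_ode_partial {μ : ℝ} (hμ : 0 < μ) (n J : ℕ) (hJ : 2 * J ≤ n + 2) :
    X ^ 2 * ((1 - X ^ 2) * derivative (derivative (∑ j ∈ Finset.range J,
          C (gegenbauerCoeff μ n j) * X ^ (n - 2 * j)))
        - C (2 * μ + 1) * X * derivative (∑ j ∈ Finset.range J,
          C (gegenbauerCoeff μ n j) * X ^ (n - 2 * j))
        + C (n * (n + 2 * μ)) * ∑ j ∈ Finset.range J,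
          C (gegenbauerCoeff μ n j) * X ^ (n - 2 * j)) =
      - C (4 * J * (n + μ - J) * gegenbauerCoeff μ n J) * X ^ (n + 2 - 2 * J) := by
  induction J with
  | zero => simp
  | succ j ih =>
    have ih := ih (by omega)
    have hm : 2 * j ≤ n := by omega
    have hjn : 2 * (j : ℝ) ≤ n := by exact_mod_cast hm
    have hB : 4 * ((j : ℝ) + 1) * (n + μ - (j + 1)) * gegenbauerCoeff μ n (j + 1) =
        - ((n - 2 * j) * (n - 2 * j - 1)) * gegenbauerCoeff μ n j := by
      rw [gegenbauerCoeff_succ_right]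
      have h3 : (j : ℝ) + 1 ≠ 0 := by positivity
      -- A vanishing denominator forces `n = 2 * j`, and then both sides are zero.
      by_cases h1 : (1 - (n : ℝ) - μ + j) = 0
      · have hn : n = 2 * j := by
          by_contra hne
          have : (2 * j + 1 : ℝ) ≤ n := by exact_mod_cast (by omega : 2 * j + 1 ≤ n)
          linarith [(Nat.cast_nonneg j : (0 : ℝ) ≤ j)]
        subst hn
        push_cast
        ring
      · field_simp
        ring
    have hd := X_mul_derivative_monomial (gegenbauerCoeff μ n j) (n - 2 * j)
    have hdd := X_sq_mul_derivative_monomial (gegenbauerCoeff μ n j) (n - 2 * j)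
    have hcast : ((n - 2 * j : ℕ) : ℝ) = n - 2 * j := by push_cast [hm]; ring
    rw [hcast] at hd hdd
    have e1 : n + 2 - 2 * (j + 1) = n - 2 * j := by omega
    have e2 : n + 2 - 2 * j = n - 2 * j + 2 := by omega
    rw [Finset.sum_range_succ, derivative_add, derivative_add, e1]
    rw [e2, pow_add] at ih
    generalize derivative (derivative (C (gegenbauerCoeff μ n j) * X ^ (n - 2 * j))) = D2 at *
    generalize derivative (C (gegenbauerCoeff μ n j) * X ^ (n - 2 * j)) = D at *
    have hB' := congrArg (C : ℝ → ℝ[X]) hB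
    simp only [map_mul, map_add, map_sub, map_neg, map_one, map_natCast, map_ofNat, Nat.cast_add,
      Nat.cast_one] at *
    linear_combination ih + (1 - X ^ 2) * hdd - (2 * C μ + 1) * X ^ 2 * hd
      + X ^ (n - 2 * j) * hB'

theorem gegenbauerPoly_ode {μ : ℝ} (hμ : 0 < μ) (n : ℕ) :
    (1 - X ^ 2) * derivative (derivative (gegenbauerPoly μ n))
      - C (2 * μ + 1) * X * derivative (gegenbauerPoly μ n)
      + C (n * (n + 2 * μ)) * gegenbauerPoly μ n = 0 := by
  have h := gegenbauerPoly_ode_partial hμ n (n / 2 + 1) (by omega)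
  rw [gegenbauerCoeff_half_add_one] at h
  rw [← gegenbauerPoly, mul_zero, C_0, neg_zero, zero_mul, mul_eq_zero] at h
  exact h.resolve_left (pow_ne_zero _ X_ne_zero)

theorem gegenbauerPoly_zero (μ : ℝ) : gegenbauerPoly μ 0 = 1 := by
  simp [gegenbauerPoly, gegenbauerCoeff, pochhammer_zero]

theorem gegenbauerPoly_eval_one_succ {μ : ℝ} (hμ : 0 < μ) (n : ℕ) :
    (n + 1) * (gegenbauerPoly μ (n + 1)).eval 1 = (n + 2 * μ) * (gegenbauerPoly μ n).eval 1 := by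
  have h := congrArg (eval 1) (gegenbauerPoly_derivative hμ n)
  simp at h
  linarith

theorem gegenbauerPoly_eval_one_pos {μ : ℝ} (hμ : 0 < μ) (n : ℕ) :
    0 < (gegenbauerPoly μ n).eval 1 := by
  induction n with
  | zero => simp [gegenbauerPoly_zero]
  | succ n ih =>
    have h := gegenbauerPoly_eval_one_succ hμ n
    have h1 : 0 < (n + 2 * μ) * (gegenbauerPoly μ n).eval 1 := by positivity
    rw [← h] at h1
    exact pos_of_mul_pos_right h1 (by positivity)

/-! ### The normalized zonal polynomials, uniformly in the dimension. -/

/-- The quotient `C_n^μ / C_n^μ(1)`, `μ = (d - 2) / 2`, as a polynomial. -/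
noncomputable def zonalPoly (d n : ℕ) : ℝ[X] :=
  if d = 2 then Polynomial.Chebyshev.T ℝ (n : ℤ)
  else C ((gegenbauerPoly (((d : ℝ) - 2) / 2) n).eval 1)⁻¹ * gegenbauerPoly (((d : ℝ) - 2) / 2) n

theorem eval_zonalPoly (d n : ℕ) (t : ℝ) :
    (zonalPoly d n).eval t = gegenbauerQuotient d n t := by
  unfold zonalPoly gegenbauerQuotient
  split_ifs
  · rfl
  · rw [eval_mul, eval_C, eval_gegenbauerPoly, eval_gegenbauerPoly, mul_comm]
    exact (div_eq_mul_inv _ _).symm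

theorem zonalPoly_zero (d : ℕ) : zonalPoly d 0 = 1 := by
  unfold zonalPoly
  split_ifs <;> simp [gegenbauerPoly_zero]

theorem half_dim_pos {d : ℕ} (hd : 2 ≤ d) (h : d ≠ 2) : 0 < ((d : ℝ) - 2) / 2 := by
  have : (3 : ℝ) ≤ d := by exact_mod_cast (by omega : 3 ≤ d)
  linarith

/-- Normalizing at `1` turns the factor `n + 2μ` into `n + 1`, so the Chebyshev case `d = 2` and the
Gegenbauer case share one formula. -/
theorem zonalPoly_derivative {d : ℕ} (hd : 2 ≤ d) (n : ℕ) :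
    (1 - X ^ 2) * derivative (zonalPoly d (n + 1)) =
      C ((n : ℝ) + 1) * (zonalPoly d n - X * zonalPoly d (n + 1)) := by
  unfold zonalPoly
  split_ifs with h
  · have := Polynomial.Chebyshev.one_sub_X_sq_mul_derivative_T_eq_poly_in_T (R := ℝ) n
    push_cast at this ⊢
    simpa using this
  · have hμ := half_dim_pos hd h
    generalize ((d : ℝ) - 2) / 2 = μ at *
    have h1 := gegenbauerPoly_derivative hμ n
    have h2 := gegenbauerPoly_eval_one_succ hμ n
    have h3 := gegenbauerPoly_eval_one_pos hμ n
    have h4 := gegenbauerPoly_eval_one_pos hμ (n + 1)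
    have h5 : (n + 2 * μ) * ((gegenbauerPoly μ (n + 1)).eval 1)⁻¹ =
        (n + 1) * ((gegenbauerPoly μ n).eval 1)⁻¹ := by
      field_simp
      linarith
    have h6 := congrArg (C : ℝ → ℝ[X]) h5
    rw [derivative_C_mul]
    rw [map_mul, map_mul] at h6
    linear_combination C (eval 1 (gegenbauerPoly μ (n + 1)))⁻¹ * h1 + gegenbauerPoly μ n * h6

theorem zonalPoly_ode {d : ℕ} (hd : 2 ≤ d) (n : ℕ) :
    (1 - X ^ 2) * derivative (derivative (zonalPoly d n))
      - C ((d : ℝ) - 1) * X * derivative (zonalPoly d n)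
      + C (n * (n + d - 2 : ℝ)) * zonalPoly d n = 0 := by
  unfold zonalPoly
  split_ifs with h
  · have := Polynomial.Chebyshev.one_sub_X_sq_mul_derivative_derivative_T_eq_poly_in_T (R := ℝ) n
    subst h
    have e : ((2 : ℕ) : ℝ) - 1 = 1 := by norm_num
    simp only [Function.iterate_succ, Function.iterate_zero, Function.comp, id] at this
    rw [this, e]
    simp
    ring
  · have h1 := gegenbauerPoly_ode (half_dim_pos hd h) n
    have e1 : 2 * (((d : ℝ) - 2) / 2) + 1 = d - 1 := by ring
    have e2 : (n : ℝ) + 2 * (((d : ℝ) - 2) / 2) = n + d - 2 := by ring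
    rw [e1, e2] at h1
    rw [derivative_C_mul, derivative_C_mul]
    linear_combination C (eval 1 (gegenbauerPoly (((d : ℝ) - 2) / 2) n))⁻¹ * h1

end SphericalHarmonics

namespace SphericalHarmonics

open Polynomial MeasureTheory

/-! ### The weight, its total mass, and the areas of spheres. -/

theorem dim_sub_one_half_pos {d : ℕ} (hd : 2 ≤ d) : 0 < ((d : ℝ) - 1) / 2 := by
  have : (2 : ℝ) ≤ d := by exact_mod_cast hd
  linarith

theorem betaIntegrand_eq {v x : ℝ} (hx : x ∈ Set.Ioo (0 : ℝ) 1) :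
    (x : ℂ) ^ ((v : ℂ) - 1) * (1 - (x : ℂ)) ^ ((v : ℂ) - 1) =
      ((x ^ (v - 1) * (1 - x) ^ (v - 1) : ℝ) : ℂ) := by
  rw [Complex.ofReal_mul, Complex.ofReal_cpow hx.1.le, Complex.ofReal_cpow (by linarith [hx.2])]
  push_cast
  rfl

theorem intervalIntegrable_beta {v : ℝ} (hv : 0 < v) :
    IntervalIntegrable (fun x : ℝ => x ^ (v - 1) * (1 - x) ^ (v - 1)) volume 0 1 := by
  have h := Complex.betaIntegral_convergent (u := v) (v := v) (by simpa) (by simpa)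
  rw [intervalIntegrable_iff_integrableOn_Ioo_of_le zero_le_one] at h ⊢
  refine h.re.congr ?_
  filter_upwards [ae_restrict_mem measurableSet_Ioo] with x hx
  rw [betaIntegrand_eq hx]
  simp

theorem integral_beta {v : ℝ} (hv : 0 < v) :
    ∫ x in (0 : ℝ)..1, x ^ (v - 1) * (1 - x) ^ (v - 1) =
      Real.Gamma v * Real.Gamma v / Real.Gamma (v + v) := by
  have h := ProbabilityTheory.beta_eq_betaIntegralReal v v hv hv
  rw [ProbabilityTheory.beta] at h
  have e : Complex.betaIntegral v v =
      ((∫ x in (0 : ℝ)..1, x ^ (v - 1) * (1 - x) ^ (v - 1) : ℝ) : ℂ) := by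
    rw [Complex.betaIntegral, ← intervalIntegral.integral_ofReal,
      intervalIntegral.integral_of_le zero_le_one, intervalIntegral.integral_of_le zero_le_one,
      integral_Ioc_eq_integral_Ioo, integral_Ioc_eq_integral_Ioo]
    exact setIntegral_congr_fun measurableSet_Ioo fun x hx => betaIntegrand_eq hx
  rw [h, e, Complex.ofReal_re]

/-- With `s = (t + 1) / 2` one has `1 - t² = 4 s (1 - s)`, which reduces the weight to a Beta
integrand. -/
theorem weight_eq_beta {d : ℕ} {t : ℝ} (ht : t ∈ Set.Ioo (-1 : ℝ) 1) :
    weight d t = 4 ^ (((d : ℝ) - 1) / 2 - 1) *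
      ((t / 2 + 1 / 2) ^ (((d : ℝ) - 1) / 2 - 1) *
        (1 - (t / 2 + 1 / 2)) ^ (((d : ℝ) - 1) / 2 - 1)) := by
  have h1 : 0 ≤ t / 2 + 1 / 2 := by linarith [ht.1]
  have h2 : 0 ≤ 1 - (t / 2 + 1 / 2) := by linarith [ht.2]
  rw [← Real.mul_rpow h1 h2, ← Real.mul_rpow (by norm_num) (mul_nonneg h1 h2), weight]
  congr 1 <;> ring

theorem integrableOn_weight {d : ℕ} (hd : 2 ≤ d) :
    IntegrableOn (weight d) (Set.Ioo (-1 : ℝ) 1) := by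
  have h := intervalIntegrable_beta (dim_sub_one_half_pos hd)
  have h2 := (h.comp_add_right (1 / 2)).comp_mul_left (c := 1 / 2)
  norm_num at h2
  rw [intervalIntegrable_iff_integrableOn_Ioo_of_le (by norm_num)] at h2
  refine IntegrableOn.congr_fun (h2.const_mul (4 ^ (((d : ℝ) - 1) / 2 - 1))) (fun t ht => ?_)
    measurableSet_Ioo
  rw [weight_eq_beta ht]
  rw [show 1 / 2 * t = t / 2 by ring]

theorem integral_weight {d : ℕ} (hd : 2 ≤ d) :
    ∫ t in Set.Ioo (-1 : ℝ) 1, weight d t =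
      √Real.pi * Real.Gamma (((d : ℝ) - 1) / 2) / Real.Gamma ((d : ℝ) / 2) := by
  have hv := dim_sub_one_half_pos hd
  rw [setIntegral_congr_fun measurableSet_Ioo fun t ht => weight_eq_beta ht,
    ← integral_Ioc_eq_integral_Ioo, ← intervalIntegral.integral_of_le (by norm_num),
    intervalIntegral.integral_const_mul,
    intervalIntegral.integral_comp_div_add
      (f := fun x : ℝ => x ^ (((d : ℝ) - 1) / 2 - 1) * (1 - x) ^ (((d : ℝ) - 1) / 2 - 1))
      two_ne_zero (1 / 2)]
  norm_num
  rw [integral_beta hv]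
  -- Legendre's duplication formula removes `Γ(2v)` from the Beta value `Γ(v)² / Γ(2v)`.
  have hD := Real.Gamma_mul_Gamma_add_half (((d : ℝ) - 1) / 2)
  rw [show ((d : ℝ) - 1) / 2 + 1 / 2 = d / 2 by ring] at hD
  rw [← two_mul]
  have g1 : 0 < Real.Gamma (2 * (((d : ℝ) - 1) / 2)) := Real.Gamma_pos_of_pos (by linarith)
  have g2 : 0 < Real.Gamma ((d : ℝ) / 2) := Real.Gamma_pos_of_pos (by linarith)
  generalize ((d : ℝ) - 1) / 2 = v at *
  have h4 : (4 : ℝ) ^ (v - 1) * 2 * 2 ^ (1 - 2 * v) = 1 := by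
    rw [show (4 : ℝ) = 2 ^ (2 : ℝ) by norm_num, ← Real.rpow_mul (by norm_num),
      ← Real.rpow_add_one (by norm_num), ← Real.rpow_add (by norm_num),
      show 2 * (v - 1) + 1 + (1 - 2 * v) = 0 by ring, Real.rpow_zero]
  have g3 : 0 < Real.Gamma v := Real.Gamma_pos_of_pos hv
  generalize Real.Gamma (2 * v) = G at *
  field_simp
  linear_combination (4 ^ (v - 1) * 2 : ℝ) * hD + G * √Real.pi * h4

theorem surfaceArea_eq {d : ℕ} (hd : 1 ≤ d) :
    surfaceArea d = 2 * √Real.pi ^ d / Real.Gamma ((d : ℝ) / 2) := by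
  have : Nonempty (Fin d) := ⟨⟨0, hd⟩⟩
  have hd' : (0 : ℝ) < d := by exact_mod_cast hd
  have hg : 0 < Real.Gamma ((d : ℝ) / 2) := Real.Gamma_pos_of_pos (by positivity)
  rw [surfaceArea, surfaceMeasure, Measure.toSphere_real_apply_univ, Measure.real,
    EuclideanSpace.volume_ball, finrank_euclideanSpace, Fintype.card_fin,
    Real.Gamma_add_one (by positivity)]
  rw [ENNReal.toReal_mul, ENNReal.toReal_ofReal (by positivity)]
  simp
  field_simp

theorem surfaceArea_eq_mul_integral_weight {d : ℕ} (hd : 2 ≤ d) :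
    surfaceArea (d - 1) * ∫ t in Set.Ioo (-1 : ℝ) 1, weight d t = surfaceArea d := by
  have hv := dim_sub_one_half_pos hd
  have g1 : 0 < Real.Gamma (((d : ℝ) - 1) / 2) := Real.Gamma_pos_of_pos hv
  have g2 : 0 < Real.Gamma ((d : ℝ) / 2) := Real.Gamma_pos_of_pos (by linarith)
  rw [integral_weight hd, surfaceArea_eq (by omega), surfaceArea_eq (by omega),
    Nat.cast_sub (by omega), Nat.cast_one]
  obtain ⟨e, rfl⟩ : ∃ e, d = e + 1 := ⟨d - 1, by omega⟩
  rw [Nat.add_sub_cancel, pow_succ]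
  field_simp

theorem weight_nonneg {d : ℕ} {t : ℝ} (ht : t ∈ Set.Ioo (-1 : ℝ) 1) : 0 ≤ weight d t :=
  Real.rpow_nonneg (by nlinarith [ht.1, ht.2]) _

theorem measurable_weight (d : ℕ) : Measurable (weight d) := by
  unfold weight
  fun_prop

theorem exists_bound_eval_Icc (q : ℝ[X]) :
    ∃ C : ℝ, ∀ t ∈ Set.Icc (-1 : ℝ) 1, |q.eval t| ≤ C :=
  isCompact_Icc.exists_bound_of_continuousOn q.continuous.continuousOn

theorem integrableOn_eval_mul_weight {d : ℕ} (hd : 2 ≤ d) (q : ℝ[X]) :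
    IntegrableOn (fun t => q.eval t * weight d t) (Set.Ioo (-1 : ℝ) 1) := by
  obtain ⟨C, hC⟩ := exists_bound_eval_Icc q
  refine (integrableOn_weight hd).bdd_mul (c := C) q.continuous.aestronglyMeasurable ?_
  filter_upwards [ae_restrict_mem measurableSet_Ioo] with t ht
  exact hC t (Set.Ioo_subset_Icc_self ht)

/-! ### Moments of the zonal polynomials. -/

/-- The integrand is the derivative of `q(t) (1 - t²)^((d-1)/2)`, which vanishes at `±1` because the
exponent is positive. Differentiability is needed only inside the interval, where even the weight
for `d = 2` is finite. -/
theorem integral_divergence_eq_zero {d : ℕ} (hd : 2 ≤ d) (q : ℝ[X]) :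
    ∫ t in Set.Ioo (-1 : ℝ) 1,
      (derivative q * (1 - X ^ 2) - C ((d : ℝ) - 1) * X * q).eval t * weight d t = 0 := by
  have hv := dim_sub_one_half_pos hd
  have hint := integrableOn_eval_mul_weight hd (derivative q * (1 - X ^ 2) - C ((d : ℝ) - 1) * X * q)
  rw [← integral_Ioc_eq_integral_Ioo, ← intervalIntegral.integral_of_le (by norm_num)]
  rw [intervalIntegral.integral_eq_sub_of_hasDerivAt_of_le (by norm_num)
    (f := fun t => q.eval t * (1 - t ^ 2) ^ (((d : ℝ) - 1) / 2))]
  · norm_num [Real.zero_rpow hv.ne']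
  · refine q.continuous.continuousOn.mul (ContinuousOn.rpow_const (by fun_prop) ?_)
    exact fun t _ => Or.inr hv.le
  · intro t ht
    have hpos : 0 < 1 - t ^ 2 := by nlinarith [ht.1, ht.2]
    have h1 : HasDerivAt (fun t : ℝ => 1 - t ^ 2) (-(2 * t)) t := by
      simpa using (hasDerivAt_pow 2 t).const_sub 1
    have h2 := (q.hasDerivAt t).mul (h1.rpow_const (p := ((d : ℝ) - 1) / 2) (Or.inl hpos.ne'))
    refine h2.congr_deriv ?_
    have e : ((d : ℝ) - 1) / 2 = ((d : ℝ) - 3) / 2 + 1 := by ring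
    rw [show ((d : ℝ) - 1) / 2 - 1 = (d - 3) / 2 by ring, e, Real.rpow_add_one hpos.ne', weight]
    simp
    ring
  · rw [intervalIntegrable_iff_integrableOn_Ioo_of_le (by norm_num)]
    exact hint

/-- The moment `ω_{d-1} ∫_{-1}^1 t^k P_n(t) (1 - t²)^{(d-3)/2} dt` of the zonal polynomial. -/
noncomputable def zonalMoment (d n k : ℕ) : ℝ :=
  surfaceArea (d - 1) *
    ∫ t in Set.Ioo (-1 : ℝ) 1, (X ^ k * zonalPoly d n).eval t * weight d t

theorem integral_eval_linear {d : ℕ} (hd : 2 ≤ d) (p q : ℝ[X]) (a b : ℝ) :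
    ∫ t in Set.Ioo (-1 : ℝ) 1, (C a * p + C b * q).eval t * weight d t =
      a * (∫ t in Set.Ioo (-1 : ℝ) 1, p.eval t * weight d t) +
        b * ∫ t in Set.Ioo (-1 : ℝ) 1, q.eval t * weight d t := by
  rw [← integral_const_mul, ← integral_const_mul, ← integral_add
    ((integrableOn_eval_mul_weight hd p).const_mul a)
    ((integrableOn_eval_mul_weight hd q).const_mul b)]
  congr 1
  ext t
  simp
  ring

/-- Take `q = t^k P_{n+1}'` in the divergence identity: the differential equation removes
`P_{n+1}''`, and the first-order relation rewrites `(1 - t²) P_{n+1}'`. For `k = 0` the truncated `k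
- 1` is harmless, being multiplied by `k`. -/
theorem zonalMoment_succ {d : ℕ} (hd : 2 ≤ d) (n k : ℕ) :
    (k + n + d - 1) * zonalMoment d (n + 1) k = k * zonalMoment d n (k - 1) := by
  have h := integral_divergence_eq_zero hd (X ^ k * derivative (zonalPoly d (n + 1)))
  have h1 := zonalPoly_derivative hd n
  have h2 := zonalPoly_ode hd (n + 1)
  have hn : (n : ℝ) + 1 ≠ 0 := by positivity
  have hX : C (k : ℝ) * X ^ k = C (k : ℝ) * X ^ (k - 1) * X := by
    cases k with
    | zero => simp
    | succ k => rw [Nat.add_sub_cancel, pow_succ]; ring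
  have e : derivative (X ^ k * derivative (zonalPoly d (n + 1))) * (1 - X ^ 2)
      - C ((d : ℝ) - 1) * X * (X ^ k * derivative (zonalPoly d (n + 1))) =
      C (k * (n + 1) : ℝ) * (X ^ (k - 1) * zonalPoly d n)
        + C (-((n + 1) * (k + n + d - 1)) : ℝ) * (X ^ k * zonalPoly d (n + 1)) := by
    rw [derivative_mul, derivative_X_pow]
    simp only [map_mul, map_add, map_sub, map_neg, map_one, map_natCast, map_ofNat,
      Nat.cast_add, Nat.cast_one] at *
    linear_combination X ^ k * h2 + (k : ℝ[X]) * X ^ (k - 1) * h1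
      + ((n : ℝ[X]) + 1) * zonalPoly d (n + 1) * hX
  rw [e, integral_eval_linear hd] at h
  unfold zonalMoment
  refine mul_left_cancel₀ hn ?_
  linear_combination -surfaceArea (d - 1) * h

theorem zonalMoment_zero_succ {d : ℕ} (hd : 2 ≤ d) (k : ℕ) :
    (k + d - 1) * zonalMoment d 0 (k + 1) = k * zonalMoment d 0 (k - 1) := by
  have h := integral_divergence_eq_zero hd (X ^ k)
  have hX : C (k : ℝ) * X ^ (k - 1) * X ^ 2 = C (k : ℝ) * X ^ (k + 1) := by
    cases k with
    | zero => simp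
    | succ k => rw [Nat.add_sub_cancel]; ring
  have e : derivative (X ^ k) * (1 - X ^ 2) - C ((d : ℝ) - 1) * X * X ^ k =
      C (k : ℝ) * (X ^ (k - 1) * zonalPoly d 0)
        + C (-(k + d - 1) : ℝ) * (X ^ (k + 1) * zonalPoly d 0) := by
    rw [derivative_X_pow, zonalPoly_zero]
    simp only [map_add, map_sub, map_neg, map_one, map_natCast] at *
    linear_combination -hX
  rw [e, integral_eval_linear hd] at h
  unfold zonalMoment
  linear_combination -surfaceArea (d - 1) * h

theorem zonalMoment_zero_zero {d : ℕ} (hd : 2 ≤ d) : zonalMoment d 0 0 = surfaceArea d := by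
  rw [zonalMoment, ← surfaceArea_eq_mul_integral_weight hd]
  simp [zonalPoly_zero]

end SphericalHarmonics

namespace SphericalHarmonics

open MvPolynomial MeasureTheory

/-! ### Integrating polynomials over the sphere by means of Gaussians. -/

theorem continuous_eval_euclidean {d : ℕ} (q : MvPolynomial (Fin d) ℝ) :
    Continuous fun y : EuclideanSpace ℝ (Fin d) => eval (fun i => y i) q :=
  (MvPolynomial.continuous_eval q).comp (by fun_prop)

theorem hasLineDerivAt_eval {d : ℕ} (i : Fin d) (q : MvPolynomial (Fin d) ℝ)
    (y : EuclideanSpace ℝ (Fin d)) :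
    HasLineDerivAt ℝ (fun y : EuclideanSpace ℝ (Fin d) => eval (fun i => y i) q)
      (eval (fun i => y i) (pderiv i q)) y (EuclideanSpace.single i 1) := by
  unfold HasLineDerivAt
  induction q using MvPolynomial.induction_on with
  | C a => simpa using hasDerivAt_const (0 : ℝ) a
  | add p q hp hq =>
    simp only [map_add]
    exact hp.add hq
  | mul_X p j hp =>
    have hX : HasDerivAt (fun t : ℝ => (y + t • EuclideanSpace.single i (1 : ℝ)) j)
        ((EuclideanSpace.single i (1 : ℝ)) j) 0 := by
      simpa using ((hasDerivAt_id (0 : ℝ)).mul_const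
        ((EuclideanSpace.single i (1 : ℝ)) j)).const_add (y j)
    have h := hp.mul hX
    simp only [eval_mul, eval_X, pderiv_mul, map_add]
    refine h.congr_deriv ?_
    by_cases hij : j = i
    · subst hij
      simp
    · simp [pderiv_X_of_ne hij, hij]

theorem hasLineDerivAt_gaussian {d : ℕ} (i : Fin d) (y : EuclideanSpace ℝ (Fin d)) :
    HasLineDerivAt ℝ (fun y : EuclideanSpace ℝ (Fin d) => Real.exp (-(1 / 2) * ‖y‖ ^ 2))
      (-(y i * Real.exp (-(1 / 2) * ‖y‖ ^ 2))) y (EuclideanSpace.single i 1) := by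
  have h := (((hasStrictFDerivAt_norm_sq y).hasFDerivAt.const_mul (-(1 / 2) : ℝ)).exp).hasLineDerivAt
    (EuclideanSpace.single i (1 : ℝ))
  have e : (Real.exp (-(1 / 2) * ‖y‖ ^ 2) • (-(1 / 2) : ℝ) • 2 • (innerSL ℝ) y)
      (EuclideanSpace.single i 1) = -(y i * Real.exp (-(1 / 2) * ‖y‖ ^ 2)) := by
    simp [EuclideanSpace.inner_single_right]
    ring
  rw [e] at h
  exact h

theorem integrable_gaussian (d : ℕ) {b : ℝ} (hb : 0 < b) :
    Integrable fun y : EuclideanSpace ℝ (Fin d) => Real.exp (-b * ‖y‖ ^ 2) := by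
  have h := GaussianFourier.integrable_cexp_neg_mul_sq_norm_add (b := (b : ℂ))
    (V := EuclideanSpace ℝ (Fin d)) (by simpa) 0 0
  refine h.re.congr (Filter.Eventually.of_forall fun y => ?_)
  have e : (-(b : ℂ) * (‖y‖ : ℂ) ^ 2 + 0 * ((inner ℝ 0 y : ℝ) : ℂ)) = ((-b * ‖y‖ ^ 2 : ℝ) : ℂ) := by
    push_cast
    ring
  change (Complex.exp _).re = _
  rw [e, Complex.exp_ofReal_re]

theorem abs_mul_exp_neg_mul_sq_le {c r s : ℝ} (hc : 0 < c) (hs : |s| ≤ r) :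
    |s * Real.exp (-c * r ^ 2)| ≤ 1 + 1 / c := by
  have h1 := Real.add_one_le_exp (c * r ^ 2)
  have hr : 0 ≤ r := (abs_nonneg s).trans hs
  have h0 : 0 ≤ c * r ^ 2 := by positivity
  rw [abs_mul, abs_of_pos (Real.exp_pos _), neg_mul, Real.exp_neg, ← div_eq_mul_inv,
    div_le_iff₀ (Real.exp_pos _)]
  have h2 : r ≤ 1 + r ^ 2 := by nlinarith [sq_nonneg (r - 1)]
  calc |s| ≤ 1 + r ^ 2 := hs.trans h2
    _ ≤ (1 + 1 / c) * (c * r ^ 2 + 1) := by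
        have : (1 + 1 / c) * (c * r ^ 2 + 1) = c * r ^ 2 + 1 + r ^ 2 + 1 / c := by
          field_simp
          ring
        have h3 : 0 < 1 / c := by positivity
        linarith
    _ ≤ _ := by gcongr

/-- Half of the exponent bounds the new coordinate factor and the other half goes to the induction
hypothesis, which is why `b` must vary. -/
theorem integrable_eval_mul_gaussian {d : ℕ} (q : MvPolynomial (Fin d) ℝ) {b : ℝ} (hb : 0 < b) :
    Integrable fun y : EuclideanSpace ℝ (Fin d) =>
      eval (fun i => y i) q * Real.exp (-b * ‖y‖ ^ 2) := by
  induction q using MvPolynomial.induction_on generalizing b with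
  | C a => simpa using (integrable_gaussian d hb).const_mul a
  | add p q hp hq =>
    simp only [map_add, add_mul]
    exact (hp hb).add (hq hb)
  | mul_X p j hp =>
    have h := (hp (half_pos hb)).bdd_mul (c := 1 + 1 / (b / 2))
      (f := fun y : EuclideanSpace ℝ (Fin d) => y j * Real.exp (-(b / 2) * ‖y‖ ^ 2))
      (Continuous.aestronglyMeasurable (by fun_prop))
      (Filter.Eventually.of_forall fun y =>
        abs_mul_exp_neg_mul_sq_le (half_pos hb) (PiLp.norm_apply_le y j))
    refine h.congr (Filter.Eventually.of_forall fun y => ?_)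
    have e : Real.exp (-b * ‖y‖ ^ 2) =
        Real.exp (-(b / 2) * ‖y‖ ^ 2) * Real.exp (-(b / 2) * ‖y‖ ^ 2) := by
      rw [← Real.exp_add]
      congr 1
      ring
    simp only [eval_mul, eval_X, e]
    ring

/-- Integration by parts, since `∂_i e^(-|y|²/2) = -y_i e^(-|y|²/2)`. -/
theorem integral_X_mul_gaussian {d : ℕ} (i : Fin d) (q : MvPolynomial (Fin d) ℝ) :
    ∫ y : EuclideanSpace ℝ (Fin d),
        eval (fun i => y i) (X i * q) * Real.exp (-(1 / 2) * ‖y‖ ^ 2) =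
      ∫ y : EuclideanSpace ℝ (Fin d),
        eval (fun i => y i) (pderiv i q) * Real.exp (-(1 / 2) * ‖y‖ ^ 2) := by
  have hb : (0 : ℝ) < 1 / 2 := by norm_num
  have e : ∀ y : EuclideanSpace ℝ (Fin d),
      eval (fun i => y i) q * -(y i * Real.exp (-(1 / 2) * ‖y‖ ^ 2)) =
        -(eval (fun i => y i) (X i * q) * Real.exp (-(1 / 2) * ‖y‖ ^ 2)) := fun y => by
    simp only [eval_mul, eval_X]
    ring
  have h := integral_bilinear_hasLineDerivAt_right_eq_neg_left_of_integrable
    (μ := (volume : Measure (EuclideanSpace ℝ (Fin d)))) (B := ContinuousLinearMap.mul ℝ ℝ)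
    (integrable_eval_mul_gaussian (pderiv i q) hb)
    ((integrable_eval_mul_gaussian (X i * q) hb).neg.congr
      (Filter.Eventually.of_forall fun y => (e y).symm))
    (integrable_eval_mul_gaussian q hb)
    (fun y _ => hasLineDerivAt_eval i q y) (fun y _ => hasLineDerivAt_gaussian i y)
  simp only [ContinuousLinearMap.mul_apply', e] at h
  rw [integral_neg, neg_inj] at h
  exact h

/-- The integral of a polynomial over the unit sphere. -/
noncomputable def sphereIntegral {d : ℕ} (q : MvPolynomial (Fin d) ℝ) : ℝ :=
  ∫ y : unitSphere d, eval (fun i => y.1 i) q ∂(surfaceMeasure d)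

theorem continuous_eval_sphere {d : ℕ} (q : MvPolynomial (Fin d) ℝ) :
    Continuous fun y : unitSphere d => eval (fun i => y.1 i) q :=
  (continuous_eval_euclidean q).comp continuous_subtype_val

theorem exists_bound_eval_sphere {d : ℕ} (q : MvPolynomial (Fin d) ℝ) :
    ∃ C : ℝ, ∀ y : unitSphere d, |eval (fun i => y.1 i) q| ≤ C := by
  obtain ⟨C, hC⟩ := isCompact_univ.exists_bound_of_continuousOn
    (continuous_eval_sphere q).continuousOn
  exact ⟨C, fun y => hC y (Set.mem_univ y)⟩

theorem integrable_eval_sphere {d : ℕ} (q : MvPolynomial (Fin d) ℝ) :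
    Integrable (fun y : unitSphere d => eval (fun i => y.1 i) q) (surfaceMeasure d) := by
  obtain ⟨C, hC⟩ := exists_bound_eval_sphere q
  exact Integrable.of_bound (continuous_eval_sphere q).aestronglyMeasurable C
    (Filter.Eventually.of_forall hC)

theorem sphereIntegral_C_mul {d : ℕ} (a : ℝ) (q : MvPolynomial (Fin d) ℝ) :
    sphereIntegral (C a * q) = a * sphereIntegral q := by
  simp [sphereIntegral, integral_const_mul]

theorem sphereIntegral_sum {d : ℕ} {ι : Type*} (s : Finset ι) (q : ι → MvPolynomial (Fin d) ℝ) :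
    sphereIntegral (∑ i ∈ s, q i) = ∑ i ∈ s, sphereIntegral (q i) := by
  simp only [sphereIntegral, map_sum]
  exact integral_finsetSum s fun i _ => integrable_eval_sphere (q i)

theorem sphereIntegral_one (d : ℕ) : sphereIntegral (1 : MvPolynomial (Fin d) ℝ) = surfaceArea d := by
  simp [sphereIntegral, surfaceArea]

/-- The radial factor `∫_0^∞ r^(m + d - 1) e^(-r²/2) dr`. -/
noncomputable def radialFactor (d m : ℕ) : ℝ :=
  ∫ r : Set.Ioi (0 : ℝ), r.1 ^ m * Real.exp (-(1 / 2) * r.1 ^ 2) ∂(Measure.volumeIoiPow (d - 1))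

theorem radialFactor_eq {d : ℕ} (hd : 1 ≤ d) (m : ℕ) :
    radialFactor d m =
      (1 / 2 : ℝ) ^ (-((m : ℝ) + d) / 2) * (1 / 2) * Real.Gamma (((m : ℝ) + d) / 2) := by
  have h := integral_rpow_mul_exp_neg_mul_rpow (p := 2) (q := (m : ℝ) + d - 1) (b := 1 / 2)
    (by norm_num)
    (by
      have : (1 : ℝ) ≤ d := by exact_mod_cast hd
      have : (0 : ℝ) ≤ m := by positivity
      linarith) (by norm_num)
  rw [show (m : ℝ) + d - 1 + 1 = m + d by ring] at h
  rw [← h]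
  simp only [radialFactor, Measure.volumeIoiPow, ENNReal.ofReal]
  rw [integral_withDensity_eq_integral_smul (by fun_prop),
    integral_subtype_comap measurableSet_Ioi
      fun a : ℝ => Real.toNNReal (a ^ (d - 1)) • (a ^ m * Real.exp (-(1 / 2) * a ^ 2))]
  refine setIntegral_congr_fun measurableSet_Ioi fun x hx => ?_
  have hx' : 0 < x := hx
  simp only [NNReal.smul_def, Real.coe_toNNReal _ (pow_nonneg hx'.le _), smul_eq_mul]
  rw [show (m : ℝ) + d - 1 = ((d - 1 + m : ℕ) : ℝ) by push_cast [hd]; ring, Real.rpow_natCast,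
    pow_add, Real.rpow_two]
  ring

theorem radialFactor_pos {d : ℕ} (hd : 1 ≤ d) (m : ℕ) : 0 < radialFactor d m := by
  have : (1 : ℝ) ≤ d := by exact_mod_cast hd
  have hg : 0 < Real.Gamma (((m : ℝ) + d) / 2) := Real.Gamma_pos_of_pos (by positivity)
  rw [radialFactor_eq hd]
  positivity

theorem radialFactor_add_two {d : ℕ} (hd : 1 ≤ d) (m : ℕ) :
    radialFactor d (m + 2) = (m + d) * radialFactor d m := by
  have : (1 : ℝ) ≤ d := by exact_mod_cast hd
  have hs : ((m : ℝ) + d) / 2 ≠ 0 := by positivity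
  rw [radialFactor_eq hd, radialFactor_eq hd]
  push_cast
  rw [show ((m : ℝ) + 2 + d) / 2 = (m + d) / 2 + 1 by ring, Real.Gamma_add_one hs,
    show -((m : ℝ) + 2 + d) / 2 = -(m + d) / 2 - 1 by ring, Real.rpow_sub_one (by norm_num)]
  ring

theorem eval_smul_of_isHomogeneous {d m : ℕ} {q : MvPolynomial (Fin d) ℝ} (hq : q.IsHomogeneous m)
    (r : ℝ) (v : Fin d → ℝ) : eval (fun i => r * v i) q = r ^ m * eval v q := by
  rw [eval_eq', eval_eq', Finset.mul_sum]
  refine Finset.sum_congr rfl fun s hs => ?_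
  have h := hq (mem_support_iff.mp hs)
  rw [Finsupp.weight_apply, Finsupp.sum_fintype _ _ (by simp)] at h
  simp only [Pi.one_apply, smul_eq_mul, mul_one] at h
  simp only [mul_pow, Finset.prod_mul_distrib, Finset.prod_pow_eq_pow_sum]
  rw [h]
  ring

/-- In polar coordinates a homogeneous polynomial times a radial function separates; the omitted
origin is a null set. -/
theorem integral_gaussian_eq {d m : ℕ} (hd : 1 ≤ d) {q : MvPolynomial (Fin d) ℝ}
    (hq : q.IsHomogeneous m) :
    ∫ y : EuclideanSpace ℝ (Fin d), eval (fun i => y i) q * Real.exp (-(1 / 2) * ‖y‖ ^ 2) =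
      sphereIntegral q * radialFactor d m := by
  have : Nonempty (Fin d) := ⟨⟨0, hd⟩⟩
  let F : unitSphere d × Set.Ioi (0 : ℝ) → ℝ := fun z =>
    eval (fun i => z.1.1 i) q * (z.2.1 ^ m * Real.exp (-(1 / 2) * z.2.1 ^ 2))
  have h1 := (volume : Measure (EuclideanSpace ℝ (Fin d))).measurePreserving_homeomorphUnitSphereProd.integral_comp
    (Homeomorph.measurableEmbedding _) F
  rw [finrank_euclideanSpace, Fintype.card_fin] at h1
  have h2 := integral_subtype_comap (μ := (volume : Measure (EuclideanSpace ℝ (Fin d))))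
    (measurableSet_singleton (0 : EuclideanSpace ℝ (Fin d))).compl
    fun y : EuclideanSpace ℝ (Fin d) => eval (fun i => y i) q * Real.exp (-(1 / 2) * ‖y‖ ^ 2)
  rw [restrict_compl_singleton] at h2
  rw [sphereIntegral, radialFactor, ← integral_prod_mul, ← h1, ← h2]
  refine integral_congr_ae (Filter.Eventually.of_forall fun y => ?_)
  have hy : ‖y.1‖ ≠ 0 := norm_ne_zero_iff.mpr y.2
  have e := eval_smul_of_isHomogeneous hq ‖y.1‖ (fun i => ‖y.1‖⁻¹ * y.1 i)
  simp only [mul_inv_cancel_left₀ hy] at e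
  simp only [F, homeomorphUnitSphereProd_apply_fst_coe, homeomorphUnitSphereProd_apply_snd_coe,
    PiLp.smul_apply, smul_eq_mul, e]
  ring

/-- In the Gaussian identity the two sides have degrees `m + 1` and `m - 1`, and their radial
factors differ by exactly `m + d - 1`. -/
theorem sphereIntegral_X_mul {d m : ℕ} (hd : 2 ≤ d) (i : Fin d) {q : MvPolynomial (Fin d) ℝ}
    (hq : q.IsHomogeneous m) :
    (m + d - 1) * sphereIntegral (X i * q) = sphereIntegral (pderiv i q) := by
  have hd1 : 1 ≤ d := by omega
  have h := integral_X_mul_gaussian i q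
  rw [integral_gaussian_eq hd1 ((isHomogeneous_X ℝ i).mul hq),
    integral_gaussian_eq hd1 (hq.pderiv (i := i))] at h
  cases m with
  -- Here the degree `m - 1` is truncated; but `q` is constant, so both sides vanish.
  | zero =>
    obtain ⟨c, rfl⟩ : ∃ c, q = C c :=
      ⟨_, totalDegree_eq_zero_iff_eq_C.mp (Nat.le_zero.mp hq.totalDegree_le)⟩
    have h0 : sphereIntegral (0 : MvPolynomial (Fin d) ℝ) = 0 := by simp [sphereIntegral]
    rw [pderiv_C, h0, zero_mul, mul_eq_zero] at h
    rw [h.resolve_right (radialFactor_pos hd1 _).ne', pderiv_C, h0, mul_zero]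
  | succ m =>
    rw [show 1 + (m + 1) = m + 2 by ring, radialFactor_add_two hd1, Nat.add_sub_cancel] at h
    refine mul_right_cancel₀ (radialFactor_pos hd1 m).ne' ?_
    push_cast
    linear_combination h

/-! ### Powers of a linear form against harmonic polynomials. -/

/-- The linear form `⟨x, ·⟩`. -/
noncomputable def linearForm {d : ℕ} (x : Fin d → ℝ) : MvPolynomial (Fin d) ℝ :=
  ∑ i, C (x i) * X i

theorem linearForm_isHomogeneous {d : ℕ} (x : Fin d → ℝ) : (linearForm x).IsHomogeneous 1 :=
  IsHomogeneous.sum _ _ _ fun i _ => isHomogeneous_C_mul_X (x i) i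

theorem linearForm_pow_isHomogeneous {d : ℕ} (x : Fin d → ℝ) (k : ℕ) :
    (linearForm x ^ k).IsHomogeneous k := by
  simpa using (linearForm_isHomogeneous x).pow k

theorem pderiv_linearForm {d : ℕ} (x : Fin d → ℝ) (i : Fin d) :
    pderiv i (linearForm x) = C (x i) := by
  rw [linearForm, map_sum, Finset.sum_eq_single i]
  · simp
  · intro j _ hj
    simp [pderiv_X_of_ne hj]
  · simp

theorem pderiv_linearForm_pow {d : ℕ} (x : Fin d → ℝ) (i : Fin d) (k : ℕ) :
    pderiv i (linearForm x ^ k) = C (k * x i) * linearForm x ^ (k - 1) := by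
  rw [pderiv_pow, pderiv_linearForm]
  simp
  ring

/-- The derivative in direction `x`. -/
noncomputable def dirDeriv {d : ℕ} (x : Fin d → ℝ) (q : MvPolynomial (Fin d) ℝ) :
    MvPolynomial (Fin d) ℝ :=
  ∑ i, C (x i) * pderiv i q

/-- The commutator of two derivations is a derivation, and this one kills every variable. -/
theorem pderiv_comm {d : ℕ} (i j : Fin d) (q : MvPolynomial (Fin d) ℝ) :
    pderiv i (pderiv j q) = pderiv j (pderiv i q) := by
  have h : ⁅(pderiv i : Derivation ℝ (MvPolynomial (Fin d) ℝ) (MvPolynomial (Fin d) ℝ)),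
      (pderiv j : Derivation ℝ (MvPolynomial (Fin d) ℝ) (MvPolynomial (Fin d) ℝ))⁆ = 0 := by
    refine MvPolynomial.derivation_ext fun k => ?_
    rw [Derivation.commutator_apply, pderiv_X, pderiv_X]
    simp [Pi.single_apply, apply_ite]
  have h2 := DFunLike.congr_fun h q
  rw [Derivation.commutator_apply] at h2
  exact sub_eq_zero.mp h2

theorem polyLaplacian_apply {d : ℕ} (q : MvPolynomial (Fin d) ℝ) :
    polyLaplacian d q = ∑ i, pderiv i (pderiv i q) := by
  simp [polyLaplacian]

theorem dirDeriv_mem_harmonicSpace {d n : ℕ} (x : Fin d → ℝ) {Y : MvPolynomial (Fin d) ℝ}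
    (hY : Y ∈ harmonicSpace d (n + 1)) : dirDeriv x Y ∈ harmonicSpace d n := by
  obtain ⟨h1, h2⟩ := hY
  refine ⟨?_, ?_⟩
  · have h1' : Y.IsHomogeneous (n + 1) := h1
    exact IsHomogeneous.sum _ _ _ fun i _ => (h1'.pderiv (i := i)).C_mul (x i)
  · have h2' : polyLaplacian d Y = 0 := h2
    change polyLaplacian d (dirDeriv x Y) = 0
    rw [polyLaplacian_apply] at h2' ⊢
    have e : ∀ i, pderiv i (pderiv i (dirDeriv x Y)) =
        ∑ j, C (x j) * pderiv j (pderiv i (pderiv i Y)) := fun i => by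
      simp only [dirDeriv, map_sum, pderiv_C_mul]
      refine Finset.sum_congr rfl fun j _ => ?_
      rw [pderiv_comm i j Y, pderiv_comm i j]
    simp only [e]
    rw [Finset.sum_comm]
    simp only [← Finset.mul_sum, ← map_sum, h2', map_zero, mul_zero, Finset.sum_const_zero]

theorem eval_dirDeriv_self {d n : ℕ} (x : Fin d → ℝ) {Y : MvPolynomial (Fin d) ℝ}
    (hY : Y.IsHomogeneous n) : eval x (dirDeriv x Y) = n * eval x Y := by
  have h := congrArg (eval x) hY.sum_X_mul_pderiv
  simpa [dirDeriv] using h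

/-- Weighting the coordinate identities for `L^k` by `x i` and summing, `|x| = 1` gives the two-step
recursion of `zonalMoment_zero_succ`. At `k = 0` this already yields the first moment, so one base
case suffices. -/
theorem sphereIntegral_linearForm_pow {d : ℕ} (hd : 2 ≤ d) {x : Fin d → ℝ}
    (hx : ∑ i, x i ^ 2 = 1) (k : ℕ) : sphereIntegral (linearForm x ^ k) = zonalMoment d 0 k := by
  induction k using Nat.strong_induction_on with
  | _ k ih =>
    cases k with
    | zero => rw [pow_zero, sphereIntegral_one, zonalMoment_zero_zero hd]
    | succ k =>
      have h : ∀ i, (k + d - 1) * (x i * sphereIntegral (X i * linearForm x ^ k)) =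
          x i ^ 2 * (k * sphereIntegral (linearForm x ^ (k - 1))) := fun i => by
        have := sphereIntegral_X_mul hd i (linearForm_pow_isHomogeneous x k)
        rw [pderiv_linearForm_pow, sphereIntegral_C_mul] at this
        linear_combination x i * this
      have h2 := Finset.sum_congr rfl fun i (_ : i ∈ Finset.univ) => h i
      rw [← Finset.mul_sum, ← Finset.sum_mul, hx, one_mul] at h2
      have e : ∑ i, x i * sphereIntegral (X i * linearForm x ^ k) =
          sphereIntegral (linearForm x ^ (k + 1)) := by
        simp only [← sphereIntegral_C_mul, ← sphereIntegral_sum]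
        rw [pow_succ', linearForm, Finset.sum_mul]
        simp only [mul_assoc]
      have hk : (k : ℝ) * sphereIntegral (linearForm x ^ (k - 1)) =
          k * zonalMoment d 0 (k - 1) := by
        rw [ih (k - 1) (by omega)]
      rw [e, hk, ← zonalMoment_zero_succ hd] at h2
      have hd' : (2 : ℝ) ≤ d := by exact_mod_cast hd
      have : (0 : ℝ) ≤ k := by positivity
      exact mul_left_cancel₀ (by linarith) h2

/-- The sphere integral inherits the recursion of `zonalMoment_succ`: `D_x Y` replaces `Y`, and its
value `(n + 1) Y(x)` at `x` cancels the Euler factor. -/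
theorem sphereIntegral_linearForm_pow_mul {d : ℕ} (hd : 2 ≤ d) {x : Fin d → ℝ}
    (hx : ∑ i, x i ^ 2 = 1) (n k : ℕ) {Y : MvPolynomial (Fin d) ℝ} (hY : Y ∈ harmonicSpace d n) :
    sphereIntegral (linearForm x ^ k * Y) = zonalMoment d n k * eval x Y := by
  induction n generalizing k Y with
  | zero =>
    have hY' : Y.IsHomogeneous 0 := hY.1
    obtain ⟨c, rfl⟩ : ∃ c, Y = C c :=
      ⟨_, totalDegree_eq_zero_iff_eq_C.mp (Nat.le_zero.mp hY'.totalDegree_le)⟩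
    rw [mul_comm, sphereIntegral_C_mul, sphereIntegral_linearForm_pow hd hx, eval_C, mul_comm]
  | succ n ih =>
    have h1 : Y.IsHomogeneous (n + 1) := hY.1
    have h2 : polyLaplacian d Y = 0 := hY.2
    rw [polyLaplacian_apply] at h2
    have h : ∀ i, (((k + n : ℕ) : ℝ) + d - 1) *
        sphereIntegral (X i * (linearForm x ^ k * pderiv i Y)) =
          sphereIntegral (pderiv i (linearForm x ^ k * pderiv i Y)) := fun i =>
      sphereIntegral_X_mul hd i
        ((linearForm_pow_isHomogeneous x k).mul (h1.pderiv (i := i)))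
    have h3 := Finset.sum_congr rfl fun i (_ : i ∈ Finset.univ) => h i
    rw [← Finset.mul_sum, ← sphereIntegral_sum, ← sphereIntegral_sum] at h3
    have e1 : ∑ i, X i * (linearForm x ^ k * pderiv i Y) =
        C ((n : ℝ) + 1) * (linearForm x ^ k * Y) := by
      have := h1.sum_X_mul_pderiv
      simp only [mul_left_comm _ (linearForm x ^ k), ← Finset.mul_sum, this]
      simp
    -- The terms in which the second derivative falls on `Y` add up to its Laplacian, which is zero.
    have e2 : ∑ i, pderiv i (linearForm x ^ k * pderiv i Y) =
        C (k : ℝ) * (linearForm x ^ (k - 1) * dirDeriv x Y) := by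
      simp only [pderiv_mul, pderiv_linearForm_pow, Finset.sum_add_distrib, ← Finset.mul_sum, h2,
        mul_zero, add_zero, dirDeriv]
      rw [Finset.mul_sum, Finset.mul_sum]
      refine Finset.sum_congr rfl fun i _ => ?_
      rw [C_mul]
      ring
    rw [e1, e2, sphereIntegral_C_mul, sphereIntegral_C_mul,
      ih (k - 1) (dirDeriv_mem_harmonicSpace x hY), eval_dirDeriv_self x h1] at h3
    have hz := zonalMoment_succ hd n k
    have hd' : (2 : ℝ) ≤ d := by exact_mod_cast hd
    have hk : (0 : ℝ) ≤ k := by positivity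
    have hn : (0 : ℝ) ≤ n := by positivity
    have hne : ((k : ℝ) + n + d - 1) * (n + 1) ≠ 0 := mul_ne_zero (by linarith) (by linarith)
    refine mul_left_cancel₀ hne ?_
    push_cast at h3
    linear_combination h3 - (n + 1) * eval x Y * hz

end SphericalHarmonics

namespace SphericalHarmonics

open Polynomial MeasureTheory

/-! ### Polynomial approximation in `L¹` and determination of measures by moments. -/

theorem integrable_eval_of_null_compl {ρ : Measure ℝ} [IsFiniteMeasure ρ]
    (hρ : ∀ᵐ t ∂ρ, t ∈ Set.Icc (-1 : ℝ) 1) (p : ℝ[X]) : Integrable (fun t => p.eval t) ρ := by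
  obtain ⟨C, hC⟩ := exists_bound_eval_Icc p
  exact Integrable.of_bound p.continuous.aestronglyMeasurable C (hρ.mono fun t ht => hC t ht)

/-- Bounded continuous functions are dense in `L¹`, and Weierstrass approximates them uniformly on
`[-1, 1]`, which carries the finite measure `ρ`. -/
theorem exists_polynomial_integral_sub_le {ρ : Measure ℝ} [IsFiniteMeasure ρ]
    (hρ : ∀ᵐ t ∂ρ, t ∈ Set.Icc (-1 : ℝ) 1) {f : ℝ → ℝ} (hf : Integrable f ρ) {ε : ℝ} (hε : 0 < ε) :
    ∃ p : ℝ[X], ∫ t, |f t - p.eval t| ∂ρ ≤ ε := by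
  obtain ⟨g, hg, hgi⟩ := hf.exists_boundedContinuous_integral_sub_le (half_pos hε)
  have hM : 0 < 2 * (ρ.real Set.univ + 1) := by positivity
  obtain ⟨p, hp⟩ := exists_polynomial_near_of_continuousOn (-1) 1 g g.continuous.continuousOn
    (ε / (2 * (ρ.real Set.univ + 1))) (by positivity)
  have hpi := integrable_eval_of_null_compl hρ p
  refine ⟨p, ?_⟩
  calc ∫ t, |f t - p.eval t| ∂ρ
      ≤ ∫ t, (‖f t - g t‖ + ε / (2 * (ρ.real Set.univ + 1))) ∂ρ := by
        refine integral_mono_ae (hf.sub hpi).abs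
          ((hf.sub hgi).norm.add (integrable_const _)) (hρ.mono fun t ht => ?_)
        have h1 := abs_sub_le (f t) (g t) (p.eval t)
        have h2 := hp t ht
        rw [abs_sub_comm] at h2
        simp only [Real.norm_eq_abs]
        linarith
    _ = (∫ t, ‖f t - g t‖ ∂ρ) + ρ.real Set.univ * (ε / (2 * (ρ.real Set.univ + 1))) := by
        have hfg : Integrable (fun t => ‖f t - g t‖) ρ := (hf.sub hgi).norm
        rw [integral_add hfg (integrable_const _), integral_const, smul_eq_mul]
    _ ≤ ε / 2 + ε / 2 := by
        gcongr
        rw [← mul_div_assoc, div_le_iff₀ hM]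
        nlinarith [measureReal_nonneg (μ := ρ) (s := Set.univ)]
    _ = ε := add_halves ε

theorem measure_ext_of_integral_polynomial {ρ ρ' : Measure ℝ} [IsFiniteMeasure ρ]
    [IsFiniteMeasure ρ'] (hρ : ∀ᵐ t ∂ρ, t ∈ Set.Icc (-1 : ℝ) 1)
    (hρ' : ∀ᵐ t ∂ρ', t ∈ Set.Icc (-1 : ℝ) 1)
    (h : ∀ p : ℝ[X], ∫ t, p.eval t ∂ρ = ∫ t, p.eval t ∂ρ') : ρ = ρ' := by
  ext s hs
  rw [← measureReal_eq_measureReal_iff]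
  refine eq_of_forall_dist_le fun ε hε => ?_
  have hadd : ∀ᵐ t ∂(ρ + ρ'), t ∈ Set.Icc (-1 : ℝ) 1 := ae_add_measure_iff.mpr ⟨hρ, hρ'⟩
  have hf : ∀ (κ : Measure ℝ) [IsFiniteMeasure κ], Integrable (s.indicator (1 : ℝ → ℝ)) κ :=
    fun κ _ => (integrable_const (1 : ℝ)).indicator hs
  -- Approximating with respect to `ρ + ρ'` yields one polynomial close to the indicator for both
  -- measures.
  obtain ⟨p, hp⟩ := exists_polynomial_integral_sub_le hadd (hf (ρ + ρ')) hε
  have hp1 := integrable_eval_of_null_compl hρ p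
  have hp2 := integrable_eval_of_null_compl hρ' p
  have hi1 : Integrable (fun t => |s.indicator 1 t - p.eval t|) ρ := ((hf ρ).sub hp1).abs
  have hi2 : Integrable (fun t => |s.indicator 1 t - p.eval t|) ρ' := ((hf ρ').sub hp2).abs
  rw [integral_add_measure hi1 hi2] at hp
  have h1 : |∫ t, (s.indicator 1 t - p.eval t) ∂ρ| ≤ ∫ t, |s.indicator 1 t - p.eval t| ∂ρ :=
    abs_integral_le_integral_abs
  have h2 : |∫ t, (s.indicator 1 t - p.eval t) ∂ρ'| ≤ ∫ t, |s.indicator 1 t - p.eval t| ∂ρ' :=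
    abs_integral_le_integral_abs
  rw [integral_sub (hf ρ) hp1, integral_indicator_one hs] at h1
  rw [integral_sub (hf ρ') hp2, integral_indicator_one hs] at h2
  rw [Real.dist_eq]
  have e : ρ.real s - ρ'.real s = (ρ.real s - ∫ t, p.eval t ∂ρ) -
      (ρ'.real s - ∫ t, p.eval t ∂ρ') := by
    rw [h p]
    ring
  rw [e]
  exact (abs_sub _ _).trans ((add_le_add h1 h2).trans hp)

/-! ### The law of `⟨x, y⟩` and the passage to integrable functions. -/

theorem surfaceArea_nonneg (d : ℕ) : 0 ≤ surfaceArea d := measureReal_nonneg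

/-- The measure `ω_{d-1} (1 - t²)^{(d-3)/2} dt` on `(-1, 1)`. -/
noncomputable def zonalMeasure (d : ℕ) : Measure ℝ :=
  (volume.restrict (Set.Ioo (-1 : ℝ) 1)).withDensity
    fun t => ENNReal.ofReal (surfaceArea (d - 1) * weight d t)

theorem measurable_zonalDensity (d : ℕ) :
    Measurable fun t => ENNReal.ofReal (surfaceArea (d - 1) * weight d t) :=
  ((measurable_weight d).const_mul _).ennreal_ofReal

theorem toReal_zonalDensity (d : ℕ) {t : ℝ} (ht : t ∈ Set.Ioo (-1 : ℝ) 1) :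
    (ENNReal.ofReal (surfaceArea (d - 1) * weight d t)).toReal =
      surfaceArea (d - 1) * weight d t :=
  ENNReal.toReal_ofReal (mul_nonneg (surfaceArea_nonneg _) (weight_nonneg ht))

theorem isFiniteMeasure_zonalMeasure {d : ℕ} (hd : 2 ≤ d) : IsFiniteMeasure (zonalMeasure d) :=
  isFiniteMeasure_withDensity_ofReal ((integrableOn_weight hd).const_mul _).2

theorem ae_zonalMeasure_mem (d : ℕ) : ∀ᵐ t ∂(zonalMeasure d), t ∈ Set.Icc (-1 : ℝ) 1 :=
  (withDensity_absolutelyContinuous _ _).ae_le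
    ((ae_restrict_mem measurableSet_Ioo).mono fun _ ht => Set.Ioo_subset_Icc_self ht)

theorem integral_zonalMeasure (d : ℕ) (h : ℝ → ℝ) :
    ∫ t, h t ∂(zonalMeasure d) =
      surfaceArea (d - 1) * ∫ t in Set.Ioo (-1 : ℝ) 1, h t * weight d t := by
  rw [zonalMeasure, integral_withDensity_eq_integral_toReal_smul (measurable_zonalDensity d)
    (Filter.Eventually.of_forall fun _ => ENNReal.ofReal_lt_top), ← integral_const_mul]
  refine setIntegral_congr_fun measurableSet_Ioo fun t ht => ?_
  simp only [toReal_zonalDensity d ht, smul_eq_mul]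
  ring

theorem integrableOn_mul_weight_of_abs {d : ℕ} {f : ℝ → ℝ}
    (hf_meas : AEStronglyMeasurable f (volume.restrict (Set.Ioo (-1 : ℝ) 1)))
    (hf : IntegrableOn (fun t : ℝ => |f t| * weight d t) (Set.Ioo (-1 : ℝ) 1)) :
    IntegrableOn (fun t => f t * weight d t) (Set.Ioo (-1 : ℝ) 1) := by
  refine Integrable.mono hf (hf_meas.mul (measurable_weight d).aestronglyMeasurable)
    (Filter.Eventually.of_forall fun t => ?_)
  simp

theorem integrable_zonalMeasure {d : ℕ} {f : ℝ → ℝ}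
    (hf_meas : AEStronglyMeasurable f (volume.restrict (Set.Ioo (-1 : ℝ) 1)))
    (hf : IntegrableOn (fun t : ℝ => |f t| * weight d t) (Set.Ioo (-1 : ℝ) 1)) :
    Integrable f (zonalMeasure d) := by
  rw [zonalMeasure, integrable_withDensity_iff_integrable_smul' (measurable_zonalDensity d)
    (Filter.Eventually.of_forall fun _ => ENNReal.ofReal_lt_top)]
  refine ((integrableOn_mul_weight_of_abs hf_meas hf).const_mul (surfaceArea (d - 1))).congr ?_
  filter_upwards [ae_restrict_mem measurableSet_Ioo] with t ht
  rw [toReal_zonalDensity d ht, smul_eq_mul]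
  ring

theorem sphereIntegral_add {d : ℕ} (p q : MvPolynomial (Fin d) ℝ) :
    sphereIntegral (p + q) = sphereIntegral p + sphereIntegral q := by
  simp only [sphereIntegral, map_add]
  exact integral_add (integrable_eval_sphere p) (integrable_eval_sphere q)

theorem sum_sq_eq_one {d : ℕ} (x : unitSphere d) : ∑ i, x.1 i ^ 2 = 1 := by
  have h := EuclideanSpace.norm_sq_eq x.1
  rw [mem_sphere_zero_iff_norm.mp x.2] at h
  simpa using h.symm

theorem eval_linearForm {d : ℕ} (x y : EuclideanSpace ℝ (Fin d)) :
    MvPolynomial.eval (fun i => y i) (linearForm fun i => x i) = inner ℝ x y := by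
  simp [linearForm, PiLp.inner_apply, mul_comm]

theorem eval_aeval_linearForm {d : ℕ} (x y : EuclideanSpace ℝ (Fin d)) (p : ℝ[X]) :
    MvPolynomial.eval (fun i => y i) (aeval (linearForm fun i => x i) p) =
      p.eval (inner ℝ x y) := by
  rw [← eval_linearForm]
  induction p using Polynomial.induction_on' with
  | add p q hp hq => simp [hp, hq]
  | monomial k a => simp [aeval_monomial, MvPolynomial.algebraMap_eq]

theorem sphereIntegral_aeval_mul {d n : ℕ} (hd : 2 ≤ d) (x : unitSphere d)
    {Y : MvPolynomial (Fin d) ℝ} (hY : Y ∈ harmonicSpace d n) (p : ℝ[X]) :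
    sphereIntegral (aeval (linearForm fun i => x.1 i) p * Y) =
      (∫ t, p.eval t * (zonalPoly d n).eval t ∂(zonalMeasure d)) *
        MvPolynomial.eval (fun i => x.1 i) Y := by
  have := isFiniteMeasure_zonalMeasure hd
  have hint : ∀ q : ℝ[X],
      Integrable (fun t => q.eval t * (zonalPoly d n).eval t) (zonalMeasure d) := fun q => by
    simpa using integrable_eval_of_null_compl (ae_zonalMeasure_mem d) (q * zonalPoly d n)
  induction p using Polynomial.induction_on' with
  | add p q hp hq =>
    simp only [map_add, add_mul, eval_add, sphereIntegral_add, hp, hq]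
    rw [integral_add (hint p) (hint q), add_mul]
  | monomial k a =>
    have h := sphereIntegral_linearForm_pow_mul hd (sum_sq_eq_one x) n k hY
    rw [aeval_monomial, MvPolynomial.algebraMap_eq, mul_assoc, sphereIntegral_C_mul, h,
      zonalMoment]
    simp only [eval_monomial, mul_assoc a]
    rw [integral_const_mul, integral_zonalMeasure]
    simp only [eval_mul, eval_pow, eval_X, mul_assoc]

theorem integral_eval_inner_mul {d n : ℕ} (hd : 2 ≤ d) (x : unitSphere d)
    {Y : MvPolynomial (Fin d) ℝ} (hY : Y ∈ harmonicSpace d n) (p : ℝ[X]) :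
    ∫ y : unitSphere d, p.eval (inner ℝ x.1 y.1) * MvPolynomial.eval (fun i => y.1 i) Y
        ∂(surfaceMeasure d) =
      (∫ t, p.eval t * (zonalPoly d n).eval t ∂(zonalMeasure d)) *
        MvPolynomial.eval (fun i => x.1 i) Y := by
  rw [← sphereIntegral_aeval_mul hd x hY p, sphereIntegral]
  simp only [map_mul, eval_aeval_linearForm]

theorem measurable_inner_sphere {d : ℕ} (x : unitSphere d) :
    Measurable fun y : unitSphere d => (inner ℝ x.1 y.1 : ℝ) :=
  Continuous.measurable (by fun_prop)

theorem inner_mem_Icc {d : ℕ} (x y : unitSphere d) : (inner ℝ x.1 y.1 : ℝ) ∈ Set.Icc (-1 : ℝ) 1 := by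
  have h := abs_real_inner_le_norm x.1 y.1
  rw [mem_sphere_zero_iff_norm.mp x.2, mem_sphere_zero_iff_norm.mp y.2, one_mul] at h
  exact abs_le.mp h

/-- The polynomial formula with `n = 0` and `Y = 1` equates all moments. As `zonalMeasure` does not
charge `±1`, the values of `f` there do not matter. -/
theorem map_inner_surfaceMeasure {d : ℕ} (hd : 2 ≤ d) (x : unitSphere d) :
    (surfaceMeasure d).map (fun y : unitSphere d => (inner ℝ x.1 y.1 : ℝ)) = zonalMeasure d := by
  have := isFiniteMeasure_zonalMeasure hd
  have hm := measurable_inner_sphere x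
  refine measure_ext_of_integral_polynomial
    ((ae_map_iff hm.aemeasurable measurableSet_Icc).mpr
      (Filter.Eventually.of_forall (inner_mem_Icc x)))
    (ae_zonalMeasure_mem d) fun p => ?_
  have h1 : (1 : MvPolynomial (Fin d) ℝ) ∈ harmonicSpace d 0 := by
    refine ⟨MvPolynomial.isHomogeneous_one _ _, ?_⟩
    change polyLaplacian d 1 = 0
    simp [polyLaplacian_apply]
  have h := integral_eval_inner_mul hd x h1 p
  rw [integral_map hm.aemeasurable p.continuous.aestronglyMeasurable]
  simpa [zonalPoly_zero] using h

theorem integral_comp_inner_mul {d n : ℕ} (hd : 2 ≤ d) (x : unitSphere d)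
    {Y : MvPolynomial (Fin d) ℝ} (hY : Y ∈ harmonicSpace d n) {f : ℝ → ℝ}
    (hf : Integrable f (zonalMeasure d)) :
    Integrable (fun y : unitSphere d =>
        f (inner ℝ x.1 y.1) * MvPolynomial.eval (fun i => y.1 i) Y) (surfaceMeasure d) ∧
      ∫ y : unitSphere d, f (inner ℝ x.1 y.1) * MvPolynomial.eval (fun i => y.1 i) Y
          ∂(surfaceMeasure d) =
        (∫ t, f t * (zonalPoly d n).eval t ∂(zonalMeasure d)) *
          MvPolynomial.eval (fun i => x.1 i) Y := by
  have := isFiniteMeasure_zonalMeasure hd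
  have hm := measurable_inner_sphere x
  have hmap := map_inner_surfaceMeasure hd x
  have hcomp : ∀ {g : ℝ → ℝ}, Integrable g (zonalMeasure d) →
      Integrable (fun y : unitSphere d => g (inner ℝ x.1 y.1)) (surfaceMeasure d) := fun {g} hg => by
    rw [← hmap] at hg
    exact hg.comp_measurable hm
  obtain ⟨A, hA⟩ := exists_bound_eval_sphere Y
  obtain ⟨B, hB⟩ := exists_bound_eval_Icc (zonalPoly d n)
  have hB' : ∀ᵐ t ∂(zonalMeasure d), ‖(zonalPoly d n).eval t‖ ≤ B :=
    (ae_zonalMeasure_mem d).mono fun t ht => hB t ht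
  have hYint : ∀ {g : ℝ → ℝ}, Integrable g (zonalMeasure d) →
      Integrable (fun y : unitSphere d =>
        g (inner ℝ x.1 y.1) * MvPolynomial.eval (fun i => y.1 i) Y) (surfaceMeasure d) :=
    fun hg => (hcomp hg).mul_bdd (c := A) (continuous_eval_sphere Y).aestronglyMeasurable
      (Filter.Eventually.of_forall hA)
  have hPint : ∀ {g : ℝ → ℝ}, Integrable g (zonalMeasure d) →
      Integrable (fun t => g t * (zonalPoly d n).eval t) (zonalMeasure d) :=
    fun hg => hg.mul_bdd (c := B) (zonalPoly d n).continuous.aestronglyMeasurable hB'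
  refine ⟨hYint hf, ?_⟩
  -- Replacing `f` by `p` changes the sphere integral by at most `A` times the `L¹` error and the
  -- right side by at most `B |Y(x)|` times it. The `+ 1` in `ε / (K + 1)` covers `K = 0`.
  set K := A + B * |MvPolynomial.eval (fun i => x.1 i) Y| with hK
  have hA0 : 0 ≤ A := (abs_nonneg _).trans (hA x)
  have hB0 : 0 ≤ B := (abs_nonneg _).trans (hB 0 (by simp))
  have hK0 : 0 ≤ K := by positivity
  refine eq_of_forall_dist_le fun ε hε => ?_
  obtain ⟨p, hp⟩ := exists_polynomial_integral_sub_le (ae_zonalMeasure_mem d) hf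
    (ε := ε / (K + 1)) (by positivity)
  have hpi := integrable_eval_of_null_compl (ae_zonalMeasure_mem d) p
  have hfp := (hf.sub hpi).abs
  have h1 : |∫ y : unitSphere d, (f (inner ℝ x.1 y.1) - p.eval (inner ℝ x.1 y.1)) *
      MvPolynomial.eval (fun i => y.1 i) Y ∂(surfaceMeasure d)| ≤
        (∫ t, |f t - p.eval t| ∂(zonalMeasure d)) * A := by
    refine abs_integral_le_integral_abs.trans ?_
    have e : ∫ t, |f t - p.eval t| ∂(zonalMeasure d) = ∫ y : unitSphere d,
        |f (inner ℝ x.1 y.1) - p.eval (inner ℝ x.1 y.1)| ∂(surfaceMeasure d) := by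
      have hfp' := hfp.aestronglyMeasurable
      rw [← hmap] at hfp' ⊢
      exact integral_map hm.aemeasurable hfp'
    rw [e, ← integral_mul_const]
    refine integral_mono (hYint (hf.sub hpi)).abs ((hcomp hfp).mul_const A) fun y => ?_
    simp only [abs_mul]
    exact mul_le_mul_of_nonneg_left (hA y) (abs_nonneg _)
  have h2 : |∫ t, (f t - p.eval t) * (zonalPoly d n).eval t ∂(zonalMeasure d)| ≤
        (∫ t, |f t - p.eval t| ∂(zonalMeasure d)) * B := by
    refine abs_integral_le_integral_abs.trans ?_
    rw [← integral_mul_const]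
    refine integral_mono_ae (hPint (hf.sub hpi)).abs (hfp.mul_const B) (hB'.mono fun t ht => ?_)
    simp only [abs_mul]
    exact mul_le_mul_of_nonneg_left ht (abs_nonneg _)
  simp only [sub_mul] at h1 h2
  rw [integral_sub (hYint hf) (hYint hpi), integral_eval_inner_mul hd x hY p] at h1
  rw [integral_sub (hPint hf) (hPint hpi)] at h2
  rw [Real.dist_eq]
  set y0 := MvPolynomial.eval (fun i => x.1 i) Y
  set I1 := ∫ y : unitSphere d, f (inner ℝ x.1 y.1) * MvPolynomial.eval (fun i => y.1 i) Y
    ∂(surfaceMeasure d)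
  set I2 := ∫ t, f t * (zonalPoly d n).eval t ∂(zonalMeasure d)
  set I3 := ∫ t, p.eval t * (zonalPoly d n).eval t ∂(zonalMeasure d)
  set δ := ∫ t, |f t - p.eval t| ∂(zonalMeasure d)
  calc |I1 - I2 * y0| = |(I1 - I3 * y0) - (I2 - I3) * y0| := by congr 1; ring
    _ ≤ |I1 - I3 * y0| + |I2 - I3| * |y0| := by
      rw [← abs_mul]
      exact abs_sub _ _
    _ ≤ δ * A + δ * B * |y0| := by gcongr
    _ = δ * K := by rw [hK]; ring
    _ ≤ ε / (K + 1) * K := by gcongr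
    _ ≤ ε := by
      rw [div_mul_eq_mul_div, div_le_iff₀ (by positivity)]
      nlinarith

end SphericalHarmonics

/-! ### The Funk–Hecke formula. -/

theorem mainTheorem5 (d : ℕ) (hd : 2 ≤ d) (f : ℝ → ℝ)
    (hf_meas : MeasureTheory.AEStronglyMeasurable f
      (MeasureTheory.volume.restrict (Set.Ioo (-1 : ℝ) 1)))
    (hf : MeasureTheory.IntegrableOn (fun t : ℝ => |f t| * SphericalHarmonics.weight d t)
      (Set.Ioo (-1 : ℝ) 1))
    (n : ℕ) :
    MeasureTheory.IntegrableOn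
      (fun t : ℝ => f t * SphericalHarmonics.gegenbauerQuotient d n t *
        SphericalHarmonics.weight d t) (Set.Ioo (-1 : ℝ) 1) ∧
    ∀ Y ∈ SphericalHarmonics.harmonicSpace d n, ∀ x : SphericalHarmonics.unitSphere d,
      MeasureTheory.Integrable
        (fun y : SphericalHarmonics.unitSphere d =>
          f (inner ℝ x.1 y.1) * MvPolynomial.eval (fun i => y.1 i) Y)
        (SphericalHarmonics.surfaceMeasure d) ∧
      ∫ y : SphericalHarmonics.unitSphere d,
          f (inner ℝ x.1 y.1) * MvPolynomial.eval (fun i => y.1 i) Y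
            ∂(SphericalHarmonics.surfaceMeasure d) =
        SphericalHarmonics.funkHeckeConstant d n f * MvPolynomial.eval (fun i => x.1 i) Y := by
  have hw := SphericalHarmonics.integrableOn_mul_weight_of_abs hf_meas hf
  have hz := SphericalHarmonics.integrable_zonalMeasure hf_meas hf
  refine ⟨?_, fun Y hY x => ?_⟩
  · obtain ⟨B, hB⟩ := SphericalHarmonics.exists_bound_eval_Icc (SphericalHarmonics.zonalPoly d n)
    have h : MeasureTheory.IntegrableOn (fun t =>
        (SphericalHarmonics.zonalPoly d n).eval t * (f t * SphericalHarmonics.weight d t))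
        (Set.Ioo (-1 : ℝ) 1) :=
      hw.bdd_mul (c := B) (SphericalHarmonics.zonalPoly d n).continuous.aestronglyMeasurable
        ((MeasureTheory.ae_restrict_mem measurableSet_Ioo).mono fun t ht =>
          hB t (Set.Ioo_subset_Icc_self ht))
    refine h.congr (Filter.Eventually.of_forall fun t => ?_)
    simp only [SphericalHarmonics.eval_zonalPoly]
    ring
  · have h := SphericalHarmonics.integral_comp_inner_mul hd x hY hz
    refine ⟨h.1, ?_⟩
    rw [h.2, SphericalHarmonics.integral_zonalMeasure, SphericalHarmonics.funkHeckeConstant]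
    simp only [SphericalHarmonics.eval_zonalPoly]
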